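/- **System.** A microservice consists of clients, workers and one database $d$. Every process is an arbitrary, possibly nondeterministic, labelled transition system; clients exchange messages only with workers, and workers only with clients and $d$, over first-in-first-out channels. A worker runs one of two versions of its program, non-updated or updated. A *relay* is the service of one client request: a client sends the request to a worker; the worker receives it, exchanges operations and results with $d$, and sends a response, which the client receives. The database processes transactions one at a time, each in three actions: receive an operation from a worker, perform it (with some result), send the result to that worker. An action of a relay is *updated* or *non-updated* according to the version of the worker that services the relay. An *update action* of a worker turns it from non-updated to updated, and takes place only when the worker is *quiescent*, i.e. it is servicing no request and awaits no database result. A relay to be serviced by a non-updated worker starts while that worker is non-updated. A *computation* is a finite or infinite interleaving of actions from an initial state, in which all workers are non-updated, no relay is in progress and all channels are empty (local states are arbitrary). **Commutation.** A database transaction $t$ (an operation with its result) *left-commutes* with $t'$ if for all database states $s,s'$: whenever $s \xrightarrow{t'}\xrightarrow{t} s'$, also $s \xrightarrow{t}\xrightarrow{t'} s'$. **Algorithm (basic commutativity-based update).** Quiescent workers are updated in any order and at any time. A client is moved to the updated service when one of its requests is assigned to be serviced by an updated worker; this is allowed only while none of its non-updated relays is in progress, and afterwards its requests are never assigned to a non-updated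 worker. A non-updated database transaction is performed only if it left-commutes with every updated transaction performed earlier. A computation is *controlled* by the algorithm if all its actions obey these rules. **Update consistency.** A computation in which all workers get updated has an *atomic update* if its update actions form one contiguous block. Two computations are *$c$-equivalent* for a client $c$ if $c$ has the same sequence of local states and actions in both. A computation $\rho$ is *update-consistent* if for every client $c$ there is a computation $\rho'$ of the system that is $c$-equivalent to $\rho$, has an atomic update, starts in the same global state, and ends in the same global state (for infinite $\rho$: coincides with $\rho$, states and actions, from some point on). **Theorem.** The basic commutativity-based update algorithm guarantees a consistent update: every finite or infinite computation that is controlled by the algorithm, and in which all workers have been updated after finitely many steps, is update-consistent. -/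

import Mathlib

universe u

/-- The two versions of the worker program: before the update and after the update. -/
inductive Version
  | nonUpdated
  | updated

/-- A microservice: clients, workers and one database, each process being an arbitrary
(possibly nondeterministic) labelled transition system, given here by its local transition
relations (source state, action label, target state). Clients exchange messages with workers only,
workers with clients and the database, and the database with workers.
The worker program depends on its version; `migrate` is the local effect of the update action. -/
structure Microservice where
  Client : Type u
  Worker : Type u
  ClientState : Type u
  WorkerState : Type u
  DbState : Type u
  Request : Type u
  Response : Type u
  Op : Type u
  Result : Type u
  clientSend : Client → ClientState → Worker → Request → ClientState → Prop
  clientRecv : Client → ClientState → Worker → Response → ClientState → Prop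
  clientInternal : Client → ClientState → ClientState → Prop
  workerRecvReq : Version → Worker → WorkerState → Client → Request → WorkerState → Prop
  workerSendOp : Version → Worker → WorkerState → Op → WorkerState → Prop
  workerRecvRes : Version → Worker → WorkerState → Result → WorkerState → Prop
  workerSendResp : Version → Worker → WorkerState → Client → Response → WorkerState → Prop
  workerInternal : Version → Worker → WorkerState → WorkerState → Prop
  migrate : Worker → WorkerState → WorkerState → Prop
  perform : DbState → Op → Result → DbState → Prop

namespace Microservice

/-- System actions. A relay is the service of one client request: the client sends it, a worker
receives it, exchanges operations and results with the database, and sends a response, which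
the client receives. The `Version` in the label of an action is the version of the worker
that services the relay to which the action belongs: it says whether the action is
non-updated or updated. (For a client's send it is the version that is to service the request.) -/
inductive Action (M : Microservice.{u}) : Type u
  | clientSend (c : M.Client) (w : M.Worker) (v : Version) (q : M.Request)
  | clientRecv (c : M.Client) (w : M.Worker) (v : Version) (p : M.Response)
  | clientInternal (c : M.Client)
  | workerRecvReq (w : M.Worker) (v : Version) (c : M.Client) (q : M.Request)
  | workerSendOp (w : M.Worker) (v : Version) (o : M.Op)
  | workerRecvRes (w : M.Worker) (v : Version) (r : M.Result)
  | workerSendResp (w : M.Worker) (v : Version) (c : M.Client) (p : M.Response)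
  | workerInternal (w : M.Worker) (v : Version)
  | update (w : M.Worker)
  | dbRecv (w : M.Worker) (v : Version) (o : M.Op)
  | dbPerform (w : M.Worker) (v : Version) (o : M.Op) (r : M.Result)
  | dbSend (w : M.Worker) (v : Version) (r : M.Result)

/-- The client that performs an action, if the action is performed by a client. -/
def Action.client? {M : Microservice.{u}} : M.Action → Option M.Client
  | .clientSend c _ _ _ => some c
  | .clientRecv c _ _ _ => some c
  | .clientInternal c => some c
  | _ => none

/-- Update actions. -/
def Action.IsUpdate {M : Microservice.{u}} : M.Action → Prop
  | .update _ => True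
  | _ => False

/-- The database handles one transaction at a time, in three actions: receive an
operation from a worker, perform it, send the result back to that worker. -/
inductive DbPhase (M : Microservice.{u}) : Type u
  | idle
  | received (w : M.Worker) (v : Version) (o : M.Op)
  | performed (w : M.Worker) (v : Version) (r : M.Result)

/-- Global states: local states, the current version of each worker, the clients whose
requests a worker is servicing (with multiplicity), the number of database operations whose
result a worker still awaits, the transaction in progress at the database, and
the contents of the first-in-first-out channels. -/
structure State (M : Microservice.{u}) where
  client : M.Client → M.ClientState
  worker : M.Worker → M.WorkerState
  version : M.Worker → Version
  serving : M.Worker → Multiset M.Client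
  awaiting : M.Worker → ℕ
  db : M.DbState
  phase : M.DbPhase
  reqs : M.Client → M.Worker → List (Version × M.Request)
  resps : M.Worker → M.Client → List (Version × M.Response)
  ops : M.Worker → List (Version × M.Op)
  results : M.Worker → List (Version × M.Result)

/-- Initially all workers are non-updated, no relay is in progress and all channels are empty. -/
def State.Initial {M : Microservice.{u}} (s : M.State) : Prop :=
  (∀ w, s.version w = .nonUpdated) ∧ (∀ w, s.serving w = 0) ∧ (∀ w, s.awaiting w = 0) ∧
  s.phase = .idle ∧ (∀ c w, s.reqs c w = []) ∧ (∀ w c, s.resps w c = []) ∧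
  (∀ w, s.ops w = []) ∧ (∀ w, s.results w = [])

/-- A worker is quiescent if it is not in the middle of any relay. -/
def State.Quiescent {M : Microservice.{u}} (s : M.State) (w : M.Worker) : Prop :=
  s.serving w = 0 ∧ s.awaiting w = 0

open scoped Classical in
/-- The transition relation of the whole system. Updates are quiescent: a worker is updated (once)
only when it is not in the middle of a relay. A relay that is to be serviced by a non-updated
worker starts while that worker is non-updated. -/
inductive Step (M : Microservice.{u}) : M.State → M.Action → M.State → Prop
  | clientSend (s : M.State) (c : M.Client) (w : M.Worker) (v : Version) (q : M.Request)
      (x : M.ClientState) (hx : M.clientSend c (s.client c) w q x)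
      (hv : v = .nonUpdated → s.version w = .nonUpdated) :
      Step M s (.clientSend c w v q)
        { s with
          client := Function.update s.client c x
          reqs := Function.update s.reqs c
            (Function.update (s.reqs c) w (s.reqs c w ++ [(v, q)])) }
  | clientRecv (s : M.State) (c : M.Client) (w : M.Worker) (v : Version) (p : M.Response)
      (x : M.ClientState) (l : List (Version × M.Response))
      (hx : M.clientRecv c (s.client c) w p x)
      (hl : s.resps w c = (v, p) :: l) :
      Step M s (.clientRecv c w v p)
        { s with
          client := Function.update s.client c x
          resps := Function.update s.resps w (Function.update (s.resps w) c l) }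
  | clientInternal (s : M.State) (c : M.Client) (x : M.ClientState)
      (hx : M.clientInternal c (s.client c) x) :
      Step M s (.clientInternal c) { s with client := Function.update s.client c x }
  | workerRecvReq (s : M.State) (w : M.Worker) (v : Version) (c : M.Client) (q : M.Request)
      (y : M.WorkerState) (l : List (Version × M.Request))
      (hy : M.workerRecvReq v w (s.worker w) c q y)
      (hv : s.version w = v)
      (hl : s.reqs c w = (v, q) :: l) :
      Step M s (.workerRecvReq w v c q)
        { s with
          worker := Function.update s.worker w y
          serving := Function.update s.serving w (c ::ₘ s.serving w)
          reqs := Function.update s.reqs c (Function.update (s.reqs c) w l) }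
  | workerSendOp (s : M.State) (w : M.Worker) (v : Version) (o : M.Op)
      (y : M.WorkerState)
      (hy : M.workerSendOp v w (s.worker w) o y)
      (hv : s.version w = v)
      (hs : s.serving w ≠ 0) :
      Step M s (.workerSendOp w v o)
        { s with
          worker := Function.update s.worker w y
          awaiting := Function.update s.awaiting w (s.awaiting w + 1)
          ops := Function.update s.ops w (s.ops w ++ [(v, o)]) }
  | workerRecvRes (s : M.State) (w : M.Worker) (v : Version) (r : M.Result)
      (y : M.WorkerState) (n : ℕ) (l : List (Version × M.Result))
      (hy : M.workerRecvRes v w (s.worker w) r y)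
      (hv : s.version w = v)
      (hn : s.awaiting w = n + 1)
      (hl : s.results w = (v, r) :: l) :
      Step M s (.workerRecvRes w v r)
        { s with
          worker := Function.update s.worker w y
          awaiting := Function.update s.awaiting w n
          results := Function.update s.results w l }
  | workerSendResp (s : M.State) (w : M.Worker) (v : Version) (c : M.Client) (p : M.Response)
      (y : M.WorkerState) (m : Multiset M.Client)
      (hy : M.workerSendResp v w (s.worker w) c p y)
      (hv : s.version w = v)
      (hm : s.serving w = c ::ₘ m) :
      Step M s (.workerSendResp w v c p)
        { s with
          worker := Function.update s.worker w y
          serving := Function.update s.serving w m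
          resps := Function.update s.resps w
            (Function.update (s.resps w) c (s.resps w c ++ [(v, p)])) }
  | workerInternal (s : M.State) (w : M.Worker) (v : Version) (y : M.WorkerState)
      (hy : M.workerInternal v w (s.worker w) y)
      (hv : s.version w = v) :
      Step M s (.workerInternal w v) { s with worker := Function.update s.worker w y }
  | update (s : M.State) (w : M.Worker) (y : M.WorkerState)
      (hy : M.migrate w (s.worker w) y)
      (hv : s.version w = .nonUpdated)
      (hq : s.Quiescent w) :
      Step M s (.update w)
        { s with
          worker := Function.update s.worker w y
          version := Function.update s.version w .updated }
  | dbRecv (s : M.State) (w : M.Worker) (v : Version) (o : M.Op) (l : List (Version × M.Op))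
      (hp : s.phase = .idle)
      (hl : s.ops w = (v, o) :: l) :
      Step M s (.dbRecv w v o)
        { s with
          phase := .received w v o
          ops := Function.update s.ops w l }
  | dbPerform (s : M.State) (w : M.Worker) (v : Version) (o : M.Op) (r : M.Result)
      (d : M.DbState)
      (hp : s.phase = .received w v o)
      (hd : M.perform s.db o r d) :
      Step M s (.dbPerform w v o r) { s with db := d, phase := .performed w v r }
  | dbSend (s : M.State) (w : M.Worker) (v : Version) (r : M.Result)
      (hp : s.phase = .performed w v r) :
      Step M s (.dbSend w v r)
        { s with
          phase := .idle
          results := Function.update s.results w (s.results w ++ [(v, r)]) }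

/-- Finite or infinite computations (interleavings) of the system. The values of `act` from
`len` on, and those of `st` beyond `len`, are irrelevant. -/
structure Computation (M : Microservice.{u}) where
  len : ℕ∞
  st : ℕ → M.State
  act : ℕ → M.Action
  initial : (st 0).Initial
  step : ∀ i : ℕ, (i : ℕ∞) < len → M.Step (st i) (act i) (st (i + 1))

namespace Computation

variable {M : Microservice.{u}}

/-- The computation performs the whole update: from some point on, all workers are updated. -/
def Updates (ρ : M.Computation) : Prop :=
  ∃ n : ℕ, (n : ℕ∞) ≤ ρ.len ∧ ∀ w, (ρ.st n).version w = .updated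

/-- The update is atomic: the update actions form one contiguous block. -/
def HasAtomicUpdate (ρ : M.Computation) : Prop :=
  ρ.Updates ∧
  ∃ i j : ℕ, ∀ n : ℕ, (n : ℕ∞) < ρ.len → ((ρ.act n).IsUpdate ↔ i ≤ n ∧ n < j)

open scoped Classical in
/-- The timeline of client `c` in the first `n` steps: its actions, each with the local state
of `c` that it leads to. -/
noncomputable def timeline (ρ : M.Computation) (c : M.Client) (n : ℕ) :
    List (M.Action × M.ClientState) :=
  ((List.range n).filter (fun i => decide ((ρ.act i).client? = some c))).map
    (fun i => (ρ.act i, (ρ.st (i + 1)).client c))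

/-- Client equivalence: client `c` starts in the same local state and has the same
(finite or infinite) timeline in both computations. -/
def ClientEquiv (c : M.Client) (ρ ρ' : M.Computation) : Prop :=
  (ρ.st 0).client c = (ρ'.st 0).client c ∧
  (∀ n : ℕ, (n : ℕ∞) ≤ ρ.len →
    ∃ m : ℕ, (m : ℕ∞) ≤ ρ'.len ∧ ρ.timeline c n <+: ρ'.timeline c m) ∧
  (∀ m : ℕ, (m : ℕ∞) ≤ ρ'.len →
    ∃ n : ℕ, (n : ℕ∞) ≤ ρ.len ∧ ρ'.timeline c m <+: ρ.timeline c n)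

/-- The two computations start in the same global state, reach the same global state
after finitely many steps, and coincide from there on. In particular, if they are finite,
they end in the same global state. -/
def SameEnds (ρ ρ' : M.Computation) : Prop :=
  ρ.st 0 = ρ'.st 0 ∧ ρ.len = ρ'.len ∧
  ∃ k : ℕ, (k : ℕ∞) ≤ ρ.len ∧
    (∀ n : ℕ, k ≤ n → (n : ℕ∞) ≤ ρ.len → ρ.st n = ρ'.st n) ∧
    (∀ n : ℕ, k ≤ n → (n : ℕ∞) < ρ.len → ρ.act n = ρ'.act n)

/-- Update consistency: for every client there is an equivalent computation of the system, with the
same initial and final global state, in which the update is atomic. -/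
def UpdateConsistent (ρ : M.Computation) : Prop :=
  ∀ c : M.Client, ∃ ρ' : M.Computation,
    ClientEquiv c ρ ρ' ∧ SameEnds ρ ρ' ∧ ρ'.HasAtomicUpdate

end Computation

/-- Database transaction `t` (an operation with its result) left-commutes with `t'`: wherever `t'`
followed by `t` can be performed, `t` followed by `t'` can be performed, with the same results
and the same final database state. -/
def LeftCommutes (M : Microservice.{u}) (t t' : M.Op × M.Result) : Prop :=
  ∀ d₀ d₁ d₂ : M.DbState, M.perform d₀ t'.1 t'.2 d₁ → M.perform d₁ t.1 t.2 d₂ →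
    ∃ e : M.DbState, M.perform d₀ t.1 t.2 e ∧ M.perform e t'.1 t'.2 d₂

/-- The memory of the basic commutativity-based update algorithm: the clients that have been
moved to the updated service, the number of non-updated relays that each client has in
progress, and the updated database transactions performed so far. -/
structure Controller (M : Microservice.{u}) where
  moved : Set M.Client
  pending : M.Client → ℕ
  log : Set (M.Op × M.Result)

namespace Controller

variable {M : Microservice.{u}}

/-- The algorithm starts with an empty memory. -/
def start (M : Microservice.{u}) : M.Controller where
  moved := ∅
  pending := fun _ => 0
  log := ∅

/-- The rules of the algorithm.
A client that has been moved to the updated service is never again assigned to a non-updated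
worker, and it is moved only when it has no non-updated relay in progress.
A non-updated database transaction is admitted only if it left-commutes with every updated
transaction performed before it. Workers may be updated in any order and at any time at
which they are quiescent, which is a premise of `Step.update`. -/
def Allows (κ : M.Controller) : M.Action → Prop
  | .clientSend c _ .nonUpdated _ => c ∉ κ.moved
  | .clientSend c _ .updated _ => κ.pending c = 0
  | .dbPerform _ .nonUpdated o r => ∀ t ∈ κ.log, M.LeftCommutes (o, r) t
  | _ => True

open scoped Classical in
/-- The change of the memory when an action takes place. -/
noncomputable def next (κ : M.Controller) : M.Action → M.Controller
  | .clientSend c _ .nonUpdated _ =>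
      { κ with pending := Function.update κ.pending c (κ.pending c + 1) }
  | .clientSend c _ .updated _ => { κ with moved := insert c κ.moved }
  | .clientRecv c _ .nonUpdated _ =>
      { κ with pending := Function.update κ.pending c (κ.pending c - 1) }
  | .dbPerform _ .updated o r => { κ with log := insert (o, r) κ.log }
  | _ => κ

end Controller

namespace Computation

variable {M : Microservice.{u}}

/-- The memory of the algorithm after `n` steps of a computation. -/
noncomputable def controller (ρ : M.Computation) : ℕ → M.Controller
  | 0 => Controller.start M
  | n + 1 => (ρ.controller n).next (ρ.act n)

/-- The computation is controlled by the basic commutativity-based update algorithm. -/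
def Controlled (ρ : M.Computation) : Prop :=
  ∀ n : ℕ, (n : ℕ∞) < ρ.len → (ρ.controller n).Allows (ρ.act n)

end Computation

end Microservice

/-! Every action has an owner: the client that performs it, or the worker whose relay it serves,
which includes the actions of the database. An event is late if its owner counts as migrated once
the action is done; a client is migrated when it has been moved to the updated service, a worker
when it is updated. Migration is permanent, so the early events of each owner precede its late ones.
The computation is sorted stably, up to a point where all workers are updated: early events, then
updates, then the other late events. The order of events within each client does not change, so one
rearrangement serves all clients.

Sorting swaps a late event with a subsequent early one, and then a late event with a subsequent
update. The owners differ in each case. A labelled late event is updated and a labelled early one is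
non-updated (`Step.migrated_iff`), so the early event never consumes a message that the late one
produced; two transactions commute by the admission rule of the algorithm (`View.swaps`). That
labels and migration agree rests on quiescence for workers, and for clients on counting the
non-updated relays in progress.

The sequential database is an obstacle: receiving an operation requires an idle database, so
individual database actions need not swap. The swaps therefore take place in a relaxed system in
which transactions may overlap. The sorted path returns to the original system
(`Path.exists_eventStep`), because the three actions of a transaction carry one version: each block
of the sort keeps transactions whole (`DbPhase.path_filter`), and one still open at the end is
updated, as all workers are. -/

namespace Microservice

/-! ### Paths and swaps in labelled transition systems -/

/-- `Path R s l t`: the labels `l` lead from `s` to `t` in the labelled transition system `R`. -/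
def Path {σ α : Type*} (R : σ → α → σ → Prop) : σ → List α → σ → Prop
  | s, [], t => s = t
  | s, a :: l, t => ∃ r, R s a r ∧ Path R r l t

/-- Whenever `a` followed by `b` is possible, so is `b` followed by `a`, with the same outcome. -/
def Swaps {σ α : Type*} (R : σ → α → σ → Prop) (a b : α) : Prop :=
  ∀ s r t, R s a r → R r b t → ∃ r', R s b r' ∧ R r' a t

namespace Path

variable {σ α : Type*} {R : σ → α → σ → Prop}

theorem append_iff {s t : σ} {l₁ l₂ : List α} :
    Path R s (l₁ ++ l₂) t ↔ ∃ r, Path R s l₁ r ∧ Path R r l₂ t := by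
  induction l₁ generalizing s with
  | nil => simp [Path]
  | cons a l ih =>
    simp only [List.cons_append, Path, ih]
    constructor
    · rintro ⟨r, h, r', h', h''⟩
      exact ⟨r', ⟨r, h, h'⟩, h''⟩
    · rintro ⟨r', ⟨r, h, h'⟩, h''⟩
      exact ⟨r, h, r', h', h''⟩

theorem move_right {s t : σ} {a : α} {l₁ l₂ : List α} (h : Path R s (a :: (l₁ ++ l₂)) t)
    (hs : ∀ b ∈ l₁, Swaps R a b) : Path R s (l₁ ++ a :: l₂) t := by
  induction l₁ generalizing s with
  | nil => exact h
  | cons b l ih =>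
    obtain ⟨r, h₁, r', h₂, h₃⟩ := h
    obtain ⟨r'', h₄, h₅⟩ := hs b (by simp) s r r' h₁ h₂
    exact ⟨r'', h₄, ih ⟨r', h₅, h₃⟩ fun b hb => hs b (by simp [hb])⟩

/-- A stable partition needs swaps only of pairs in the wrong order: by induction the tail is
partitioned already, and a head that fails `p` moves past the tail's entries that satisfy `p`. -/
theorem filter_append_filter_not {s t : σ} {l : List α} (p : α → Bool) (h : Path R s l t)
    (hs : l.Pairwise fun a b => p a = false → p b = true → Swaps R a b) :
    Path R s (l.filter p ++ l.filter fun a => !p a) t := by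
  induction l generalizing s with
  | nil => exact h
  | cons a l ih =>
    obtain ⟨r, h₁, h₂⟩ := h
    rw [List.pairwise_cons] at hs
    have h₃ := ih h₂ hs.2
    cases hp : p a with
    | true => simpa [hp] using ⟨r, h₁, h₃⟩
    | false =>
      simp only [List.filter_cons, hp, Bool.not_false, if_true, Bool.false_eq_true, if_false]
      refine move_right ⟨r, h₁, h₃⟩ fun b hb => ?_
      rw [List.mem_filter] at hb
      exact hs.1 b hb.1 hp hb.2

theorem exists_states {s t : σ} {l : List α} (h : Path R s l t) :
    ∃ f : ℕ → σ, f 0 = s ∧ f l.length = t ∧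
      ∀ i (hi : i < l.length), R (f i) l[i] (f (i + 1)) := by
  induction l generalizing s with
  | nil => exact ⟨fun _ => s, rfl, h, fun i hi => absurd hi (by simp)⟩
  | cons a l ih =>
    obtain ⟨r, h₁, h₂⟩ := h
    obtain ⟨f, h0, ht, hf⟩ := ih h₂
    refine ⟨fun n => Nat.casesOn n s f, rfl, ht, fun i hi => ?_⟩
    cases i with
    | zero => simpa [h0] using h₁
    | succ i => exact hf i (by simpa using hi)

theorem of_states {β : Type*} {R' : β → α → β → Prop} {f : ℕ → β} {g : ℕ → α} {n : ℕ}
    (h : ∀ i < n, R' (f i) (g i) (f (i + 1))) :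
    Path R' (f 0) ((List.range n).map g) (f n) := by
  induction n with
  | zero => rfl
  | succ n ih =>
    rw [List.range_succ, List.map_append, append_iff]
    exact ⟨f n, ih fun i hi => h i (by omega), f (n + 1), h n (by omega), rfl⟩

end Path

theorem _root_.List.filter_append_filter_not_of_pairwise {α : Type*} {p : α → Bool} {l : List α}
    (h : l.Pairwise fun a b => p a = false → p b = false) :
    l.filter p ++ l.filter (fun a => !p a) = l := by
  induction l with
  | nil => rfl
  | cons a l ih =>
    rw [List.pairwise_cons] at h
    cases hp : p a with
    | true => simp [hp, ih h.2]
    | false =>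
      have h₁ : l.filter p = [] := List.filter_eq_nil_iff.2 fun b hb => by simp [h.1 b hb hp]
      have := ih h.2
      simp only [h₁, List.nil_append] at this
      simp [hp, h₁, this]

open scoped Classical

noncomputable section

variable {M : Microservice.{u}}

/-! ### Owners of actions and the relaxed system -/

/-- The owner of an action: the client that performs it, or else the worker that
services the relay to which the action belongs. -/
inductive Tag (M : Microservice.{u}) : Type u
  | client (c : M.Client)
  | worker (w : M.Worker)

/-- The part of the global state that only a given worker changes. -/
structure WorkerLocal (M : Microservice.{u}) : Type u where
  state : M.WorkerState
  version : Version
  serving : Multiset M.Client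
  awaiting : ℕ

abbrev Tag.Local : M.Tag → Type u
  | .client _ => M.ClientState
  | .worker _ => M.WorkerLocal

/-- The channels of the system, and two internal channels of the database for each worker that
hold an operation not yet performed and a result not yet sent. -/
inductive Channel (M : Microservice.{u}) : Type u
  | request (c : M.Client) (w : M.Worker)
  | response (w : M.Worker) (c : M.Client)
  | operation (w : M.Worker)
  | received (w : M.Worker)
  | performed (w : M.Worker)
  | result (w : M.Worker)

abbrev Channel.Message : M.Channel → Type u
  | .request _ _ => M.Request
  | .response _ _ => M.Response
  | .operation _ => M.Op
  | .received _ => M.Op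
  | .performed _ => M.Result
  | .result _ => M.Result

/-- States of the relaxed system, in which the database may
process several transactions at a time. -/
@[ext]
structure View (M : Microservice.{u}) where
  loc : ∀ t : M.Tag, t.Local
  db : M.DbState
  chan : ∀ h : M.Channel, List (Version × h.Message)

/-- The single slot of the database is spread over one queue per worker, so that database actions
for different workers touch different channels. -/
def DbPhase.receivedFrom : M.DbPhase → M.Worker → List (Version × M.Op)
  | .received w v o, w' => if w = w' then [(v, o)] else []
  | _, _ => []

def DbPhase.performedFor : M.DbPhase → M.Worker → List (Version × M.Result)
  | .performed w v r, w' => if w = w' then [(v, r)] else []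
  | _, _ => []

def State.loc (s : M.State) : ∀ t : M.Tag, t.Local
  | .client c => s.client c
  | .worker w => ⟨s.worker w, s.version w, s.serving w, s.awaiting w⟩

def State.chan (s : M.State) : ∀ h : M.Channel, List (Version × h.Message)
  | .request c w => s.reqs c w
  | .response w c => s.resps w c
  | .operation w => s.ops w
  | .received w => s.phase.receivedFrom w
  | .performed w => s.phase.performedFor w
  | .result w => s.results w

def State.view (s : M.State) : M.View := ⟨s.loc, s.db, s.chan⟩

theorem State.eq_of_view_eq {s t : M.State} (h : s.view = t.view) (hp : s.phase = t.phase) :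
    s = t := by
  have hl (x) : s.loc x = t.loc x := congrFun (congrArg View.loc h) x
  have hc (x) : s.chan x = t.chan x := congrFun (congrArg View.chan h) x
  have hd : s.db = t.db := congrArg View.db h
  have hw (w) := WorkerLocal.mk.inj (hl (.worker w))
  cases s
  cases t
  simp only [State.mk.injEq]
  exact ⟨funext fun c => hl (.client c), funext fun w => (hw w).1, funext fun w => (hw w).2.1,
    funext fun w => (hw w).2.2.1, funext fun w => (hw w).2.2.2, hd, hp,
    funext fun c => funext fun w => hc (.request c w),
    funext fun w => funext fun c => hc (.response w c),
    funext fun w => hc (.operation w), funext fun w => hc (.result w)⟩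

namespace Action

def tag : M.Action → M.Tag
  | clientSend c _ _ _ => .client c
  | clientRecv c _ _ _ => .client c
  | clientInternal c => .client c
  | workerRecvReq w _ _ _ => .worker w
  | workerSendOp w _ _ => .worker w
  | workerRecvRes w _ _ => .worker w
  | workerSendResp w _ _ _ => .worker w
  | workerInternal w _ => .worker w
  | update w => .worker w
  | dbRecv w _ _ => .worker w
  | dbPerform w _ _ _ => .worker w
  | dbSend w _ _ => .worker w

theorem client?_eq_some_iff {a : M.Action} {c : M.Client} :
    a.client? = some c ↔ a.tag = .client c := by
  cases a <;> simp [client?, tag]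

/-- The version in the label of an action. -/
def label? : M.Action → Option Version
  | clientSend _ _ v _ => some v
  | clientRecv _ _ v _ => some v
  | clientInternal _ => none
  | workerRecvReq _ v _ _ => some v
  | workerSendOp _ v _ => some v
  | workerRecvRes _ v _ => some v
  | workerSendResp _ v _ _ => some v
  | workerInternal _ v => some v
  | update _ => none
  | dbRecv _ v _ => some v
  | dbPerform _ v _ _ => some v
  | dbSend _ v _ => some v

/-- The database transaction that an action performs. -/
def transaction? : M.Action → Option (M.Op × M.Result)
  | dbPerform _ _ o r => some (o, r)
  | _ => none

/-- The message `m` in channel `h`, and nothing elsewhere. -/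
def single (h : M.Channel) (m : Version × h.Message) :
    ∀ h : M.Channel, List (Version × h.Message) :=
  Function.update (fun _ => []) h [m]

/-- The messages that an action consumes. -/
def pop : M.Action → ∀ h : M.Channel, List (Version × h.Message)
  | clientRecv c w v p => single (.response w c) (v, p)
  | workerRecvReq w v c q => single (.request c w) (v, q)
  | workerRecvRes w v r => single (.result w) (v, r)
  | dbRecv w v o => single (.operation w) (v, o)
  | dbPerform w v o _ => single (.received w) (v, o)
  | dbSend w v r => single (.performed w) (v, r)
  | _ => fun _ => []

/-- The messages that an action produces. -/
def push : M.Action → ∀ h : M.Channel, List (Version × h.Message)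
  | clientSend c w v q => single (.request c w) (v, q)
  | workerSendOp w v o => single (.operation w) (v, o)
  | workerSendResp w v c p => single (.response w c) (v, p)
  | dbRecv w v o => single (.received w) (v, o)
  | dbPerform w v _ r => single (.performed w) (v, r)
  | dbSend w v r => single (.result w) (v, r)
  | _ => fun _ => []

/-- The local transitions of the owner of an action. -/
def Moves : (a : M.Action) → a.tag.Local → a.tag.Local → Prop
  | clientSend c w _ q, x, y => M.clientSend c x w q y
  | clientRecv c w _ p, x, y => M.clientRecv c x w p y
  | clientInternal c, x, y => M.clientInternal c x y
  | workerRecvReq w v c q, x, y => x.version = v ∧ ∃ z, M.workerRecvReq v w x.state c q z ∧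
      y = { x with state := z, serving := c ::ₘ x.serving }
  | workerSendOp w v o, x, y => x.version = v ∧ x.serving ≠ 0 ∧
      ∃ z, M.workerSendOp v w x.state o z ∧ y = { x with state := z, awaiting := x.awaiting + 1 }
  | workerRecvRes w v r, x, y => x.version = v ∧ ∃ z n, M.workerRecvRes v w x.state r z ∧
      x.awaiting = n + 1 ∧ y = { x with state := z, awaiting := n }
  | workerSendResp w v c p, x, y => x.version = v ∧ ∃ z m, M.workerSendResp v w x.state c p z ∧
      x.serving = c ::ₘ m ∧ y = { x with state := z, serving := m }
  | workerInternal w v, x, y => x.version = v ∧ ∃ z, M.workerInternal v w x.state z ∧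
      y = { x with state := z }
  | update w, x, y => x.version = .nonUpdated ∧ x.serving = 0 ∧ x.awaiting = 0 ∧
      ∃ z, M.migrate w x.state z ∧ y = { x with state := z, version := .updated }
  | dbRecv _ _ _, x, y => y = x
  | dbPerform _ _ _ _, x, y => y = x
  | dbSend _ _ _, x, y => y = x

/-- The effect of an action on the database. -/
def Transacts (a : M.Action) (d d' : M.DbState) : Prop :=
  match a.transaction? with
  | none => d' = d
  | some t => M.perform d t.1 t.2 d'

end Action

def Channel.receiver : M.Channel → M.Tag
  | .request _ w => .worker w
  | .response _ c => .client c
  | .operation w => .worker w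
  | .received w => .worker w
  | .performed w => .worker w
  | .result w => .worker w

def Channel.sender : M.Channel → M.Tag
  | .request c _ => .client c
  | .response w _ => .worker w
  | .operation w => .worker w
  | .received w => .worker w
  | .performed w => .worker w
  | .result w => .worker w

theorem Action.mem_single {h h' : M.Channel} {m : Version × h.Message}
    {m' : Version × h'.Message} (hm : m' ∈ single h m h') : h' = h ∧ m'.1 = m.1 := by
  by_cases e : h' = h
  · subst e
    simp only [single, Function.update_self, List.mem_singleton] at hm
    simp [hm]
  · simp [single, Function.update_of_ne e] at hm

theorem Action.of_mem_pop {a : M.Action} {h : M.Channel} {m : Version × h.Message}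
    (hm : m ∈ a.pop h) : a.tag = h.receiver ∧ a.label? = some m.1 := by
  cases a <;> simp only [pop, List.not_mem_nil] at hm <;>
    · obtain ⟨rfl, e⟩ := mem_single hm
      exact ⟨rfl, by rw [e]; rfl⟩

theorem Action.of_mem_push {a : M.Action} {h : M.Channel} {m : Version × h.Message}
    (hm : m ∈ a.push h) : a.tag = h.sender ∧ a.label? = some m.1 := by
  cases a <;> simp only [push, List.not_mem_nil] at hm <;>
    · obtain ⟨rfl, e⟩ := mem_single hm
      exact ⟨rfl, by rw [e]; rfl⟩

/-- An action with the local state of its owner to which it leads, and a flag that says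
whether the action belongs to the time after the owner was moved to the updated service. -/
structure Event (M : Microservice.{u}) where
  act : M.Action
  dest : act.tag.Local
  late : Bool

/-- The transition relation of the relaxed system. -/
def View.Step (S : M.View) (e : M.Event) (S' : M.View) : Prop :=
  e.act.Moves (S.loc e.act.tag) e.dest ∧ S'.loc = Function.update S.loc e.act.tag e.dest ∧
  e.act.Transacts S.db S'.db ∧ ∀ h, e.act.pop h ++ S'.chan h = S.chan h ++ e.act.push h

/-! ### Commutation of independent events -/

/-- One channel, under an event that consumes `P` and produces `Q`, followed by one that consumes
`P'` and produces `Q'`. The delicate case is production followed by consumption: since `P'` and `Q`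
are disjoint, what is consumed was in `S` from the start. -/
theorem swap_append {α : Type*} {S S₁ S₂ P Q P' Q' : List α} (h₁ : P ++ S₁ = S ++ Q)
    (h₂ : P' ++ S₂ = S₁ ++ Q') (hP : P = [] ∨ P' = []) (hQ : Q = [] ∨ Q' = [])
    (hPQ : P = [] ∨ Q = []) (hPQ' : P' = [] ∨ Q' = []) (hd : ∀ x ∈ Q, x ∉ P') :
    ∃ T, P' ++ T = S ++ Q' ∧ P ++ S₂ = T ++ Q := by
  rcases hP with rfl | rfl <;> rcases hQ with rfl | rfl
  · simp only [List.nil_append, List.append_nil] at *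
    subst h₁
    exact ⟨S₂, h₂, rfl⟩
  · simp only [List.nil_append, List.append_nil] at *
    subst h₁
    -- Either `P'` is a prefix of `S`, or it reaches into `Q` by a piece `T`, which disjointness
    -- forces to be empty.
    rcases List.append_eq_append_iff.1 h₂ with ⟨T, e₁, e₂⟩ | ⟨T, e₁, e₂⟩
    · exact ⟨T, e₁.symm, e₂⟩
    · cases T with
      | nil => exact ⟨[], by simpa using e₁, by simpa using e₂.symm⟩
      | cons x T => exact absurd (by simp [e₁]) (hd x (by simp [e₂]))
  · simp only [List.nil_append, List.append_nil] at *
    subst h₁ h₂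
    exact ⟨_, rfl, by simp⟩
  · simp only [List.nil_append, List.append_nil] at *
    subst h₂
    exact ⟨S, rfl, h₁⟩

theorem Action.pop_eq_nil_or_push_eq_nil (a : M.Action) (h : M.Channel) :
    a.pop h = [] ∨ a.push h = [] := by
  cases a <;> simp only [pop, push, true_or, or_true] <;>
    · simp only [single]
      cases h <;> simp [Function.update]

theorem eq_nil_or_eq_nil {α β : Type*} {l : List α} {l' : List β}
    (h : ∀ a ∈ l, ∀ b ∈ l', False) : l = [] ∨ l' = [] := by
  cases l with
  | nil => exact .inl rfl
  | cons a l => cases l' with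
    | nil => exact .inr rfl
    | cons b l' => exact (h a (by simp) b (by simp)).elim

/-- Each channel has one sender and one receiver, so different owners never both produce to it or
both consume from it. Different labels exclude that `b` consumes what `a` produced. The database
matters only if both events perform a transaction. -/
theorem View.swaps {a b : M.Event} (ht : a.act.tag ≠ b.act.tag)
    (hl : ∀ v, a.act.label? = some v → b.act.label? ≠ some v)
    (hd : ∀ t t', a.act.transaction? = some t → b.act.transaction? = some t' →
      M.LeftCommutes t' t) : Swaps (View.Step (M := M)) a b := by
  rintro S S₁ S₂ ⟨ha₁, ha₂, ha₃, ha₄⟩ ⟨hb₁, hb₂, hb₃, hb₄⟩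
  have hdb : ∃ d, b.act.Transacts S.db d ∧ a.act.Transacts d S₂.db := by
    unfold Action.Transacts at *
    cases hat : a.act.transaction? with
    | none =>
      rw [hat] at ha₃
      exact ⟨S₂.db, by rw [← ha₃]; exact hb₃, rfl⟩
    | some t =>
      rw [hat] at ha₃
      cases hbt : b.act.transaction? with
      | none =>
        rw [hbt] at hb₃
        exact ⟨S.db, rfl, by rw [hb₃]; exact ha₃⟩
      | some t' =>
        rw [hbt] at hb₃
        exact hd t t' hat hbt _ _ _ ha₃ hb₃
  obtain ⟨d, hd₁, hd₂⟩ := hdb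
  have hch (h) := swap_append (ha₄ h) (hb₄ h)
    (eq_nil_or_eq_nil fun m hm m' hm' =>
      ht ((Action.of_mem_pop hm).1.trans (Action.of_mem_pop hm').1.symm))
    (eq_nil_or_eq_nil fun m hm m' hm' =>
      ht ((Action.of_mem_push hm).1.trans (Action.of_mem_push hm').1.symm))
    (a.act.pop_eq_nil_or_push_eq_nil h) (b.act.pop_eq_nil_or_push_eq_nil h)
    fun m hm hm' => hl _ (Action.of_mem_push hm).2 (Action.of_mem_pop hm').2
  choose T hT₁ hT₂ using hch
  refine ⟨⟨Function.update S.loc b.act.tag b.dest, d, T⟩, ⟨?_, rfl, hd₁, hT₁⟩, ?_, ?_, hd₂, hT₂⟩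
  · rwa [ha₂, Function.update_of_ne ht.symm] at hb₁
  · dsimp only
    rwa [Function.update_of_ne ht]
  · rw [hb₂, ha₂, Function.update_comm ht]

/-! ### Passage between the system and the relaxed system -/

/-- The effect of an action on the transaction in progress at the database. -/
def DbPhase.Step : M.DbPhase → M.Action → M.DbPhase → Prop
  | ph, .dbRecv w v o, ph' => ph = .idle ∧ ph' = .received w v o
  | ph, .dbPerform w v o r, ph' => ph = .received w v o ∧ ph' = .performed w v r
  | ph, .dbSend w v r, ph' => ph = .performed w v r ∧ ph' = .idle
  | ph, _, ph' => ph' = ph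

/-- An event fixes the local state reached and all channel contents; only the database state remains
open, as `perform` may be nondeterministic. -/
theorem State.view_ext {s : M.State} {a : M.Action} {x : a.tag.Local} {l : Bool} {S : M.View}
    {s' : M.State} (h : s.view.Step ⟨a, x, l⟩ S) (h' : s.view.Step ⟨a, x, l⟩ s'.view)
    (hd : s'.db = S.db) : s'.view = S := by
  refine View.ext (h'.2.1.trans h.2.1.symm) hd (funext fun c => ?_)
  exact List.append_cancel_left ((h'.2.2.2 c).trans (h.2.2.2 c).symm)

theorem Action.single_request (c c' : M.Client) (w w' : M.Worker) (m : Version × M.Request) :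
    single (.request c w) m (.request c' w') = if c' = c ∧ w' = w then [m] else [] := by
  split <;> rename_i h
  · obtain ⟨rfl, rfl⟩ := h
    exact Function.update_self ..
  · exact Function.update_of_ne (by simpa using h) ..

theorem Action.single_response (c c' : M.Client) (w w' : M.Worker) (m : Version × M.Response) :
    single (.response w c) m (.response w' c') = if c' = c ∧ w' = w then [m] else [] := by
  split <;> rename_i h
  · obtain ⟨rfl, rfl⟩ := h
    exact Function.update_self ..
  · exact Function.update_of_ne (by rw [and_comm] at h; simpa using h) ..

theorem Action.single_operation (w w' : M.Worker) (m : Version × M.Op) :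
    single (.operation w) m (.operation w') = if w' = w then [m] else [] := by
  split <;> rename_i h
  · subst h
    exact Function.update_self ..
  · exact Function.update_of_ne (by simpa using h) ..

theorem Action.single_received (w w' : M.Worker) (m : Version × M.Op) :
    single (.received w) m (.received w') = if w' = w then [m] else [] := by
  split <;> rename_i h
  · subst h
    exact Function.update_self ..
  · exact Function.update_of_ne (by simpa using h) ..

theorem Action.single_performed (w w' : M.Worker) (m : Version × M.Result) :
    single (.performed w) m (.performed w') = if w' = w then [m] else [] := by
  split <;> rename_i h
  · subst h
    exact Function.update_self ..
  · exact Function.update_of_ne (by simpa using h) ..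

theorem Action.single_result (w w' : M.Worker) (m : Version × M.Result) :
    single (.result w) m (.result w') = if w' = w then [m] else [] := by
  split <;> rename_i h
  · subst h
    exact Function.update_self ..
  · exact Function.update_of_ne (by simpa using h) ..

theorem Action.single_of_ne {h h' : M.Channel} (m : Version × h.Message) (hh : h' ≠ h) :
    single h m h' = [] :=
  Function.update_of_ne hh ..

theorem Step.loc_of_ne {s s' : M.State} {a : M.Action} (h : M.Step s a s') {t : M.Tag}
    (ht : t ≠ a.tag) : s'.loc t = s.loc t := by
  cases h <;> cases t <;> simp_all [State.loc, Action.tag]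

theorem Step.chan {s s' : M.State} {a : M.Action} (h : M.Step s a s') (k : M.Channel) :
    a.pop k ++ s'.chan k = s.chan k ++ a.push k := by
  cases h <;> cases k <;>
    simp only [State.chan, Action.pop, Action.push, Action.single_request, Action.single_response,
      Action.single_operation, Action.single_received, Action.single_performed,
      Action.single_result, Action.single_of_ne, ne_eq, reduceCtorEq, not_false_eq_true,
      List.nil_append, List.append_nil, Function.update_apply, DbPhase.receivedFrom,
      DbPhase.performedFor, *] <;>
    grind

theorem Step.view {s s' : M.State} {a : M.Action} (h : M.Step s a s') (l : Bool) :
    s.view.Step ⟨a, s'.loc a.tag, l⟩ s'.view := by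
  refine ⟨?_, Function.eq_update_iff.2 ⟨rfl, fun t => h.loc_of_ne⟩, ?_, h.chan⟩
  · cases h <;> simp_all [Action.Moves, State.view, State.loc, Action.tag, State.Quiescent]
  · cases h <;> simp_all [Action.Transacts, Action.transaction?, State.view]

theorem Step.phase {s s' : M.State} {a : M.Action} (h : M.Step s a s') :
    s.phase.Step a s'.phase := by
  cases h <;> simp_all [DbPhase.Step]

/-- Steps of the relaxed system in which the database handles one transaction at a time
are steps of the system. -/
theorem View.Step.exists_step {s : M.State} {e : M.Event} {S : M.View} {ph : M.DbPhase}
    (h : s.view.Step e S) (hp : s.phase.Step e.act ph)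
    (hv : ∀ c w q, e.act = .clientSend c w .nonUpdated q → s.version w = .nonUpdated) :
    ∃ s' : M.State, M.Step s e.act s' ∧ s'.view = S ∧ s'.phase = ph := by
  obtain ⟨a, x, l⟩ := e
  suffices H : ∃ s' : M.State, M.Step s a s' ∧ s'.loc a.tag = x ∧ s'.db = S.db ∧ s'.phase = ph by
    obtain ⟨s', h₁, rfl, h₃, h₄⟩ := H
    exact ⟨s', h₁, State.view_ext h (h₁.view l) h₃, h₄⟩
  obtain ⟨h₁, -, h₂, h₃⟩ := h
  dsimp only at h₁ h₂ h₃ hp hv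
  cases a with
  | clientSend c w v q =>
    refine ⟨_, .clientSend s c w v q x h₁ ?_, ?_, h₂.symm, hp.symm⟩
    · rintro rfl
      exact hv c w q rfl
    · exact Function.update_self (β := fun _ : M.Client => M.ClientState) c x s.client
  | clientRecv c w v p =>
    have hl := h₃ (.response w c)
    simp only [Action.pop, Action.push, Action.single_response, and_self, if_true,
      List.append_nil] at hl
    refine ⟨_, .clientRecv s c w v p x _ h₁ hl.symm, ?_, h₂.symm, hp.symm⟩
    exact Function.update_self (β := fun _ : M.Client => M.ClientState) c x s.client
  | clientInternal c =>
    refine ⟨_, .clientInternal s c x h₁, ?_, h₂.symm, hp.symm⟩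
    exact Function.update_self (β := fun _ : M.Client => M.ClientState) c x s.client
  | workerRecvReq w v c q =>
    have hl := h₃ (.request c w)
    simp only [Action.pop, Action.push, Action.single_request, and_self, if_true,
      List.append_nil] at hl
    obtain ⟨hv, z, hz, rfl⟩ := h₁
    refine ⟨_, .workerRecvReq s w v c q z _ hz hv hl.symm, ?_, h₂.symm, hp.symm⟩
    simp [State.loc, State.view, Action.tag]
  | workerSendOp w v o =>
    obtain ⟨hv, hs, z, hz, rfl⟩ := h₁
    refine ⟨_, .workerSendOp s w v o z hz hv hs, ?_, h₂.symm, hp.symm⟩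
    simp [State.loc, State.view, Action.tag]
  | workerRecvRes w v r =>
    have hl := h₃ (.result w)
    simp only [Action.pop, Action.push, Action.single_result, if_true, List.append_nil] at hl
    obtain ⟨hv, z, n, hz, hn, rfl⟩ := h₁
    refine ⟨_, .workerRecvRes s w v r z n _ hz hv hn hl.symm, ?_, h₂.symm, hp.symm⟩
    simp [State.loc, State.view, Action.tag]
  | workerSendResp w v c p =>
    obtain ⟨hv, z, m, hz, hm, rfl⟩ := h₁
    refine ⟨_, .workerSendResp s w v c p z m hz hv hm, ?_, h₂.symm, hp.symm⟩
    simp [State.loc, State.view, Action.tag]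
  | workerInternal w v =>
    obtain ⟨hv, z, hz, rfl⟩ := h₁
    refine ⟨_, .workerInternal s w v z hz hv, ?_, h₂.symm, hp.symm⟩
    simp [State.loc, State.view, Action.tag]
  | update w =>
    obtain ⟨hv, hs, ha, z, hz, rfl⟩ := h₁
    refine ⟨_, .update s w z hz hv ⟨hs, ha⟩, ?_, h₂.symm, hp.symm⟩
    simp [State.loc, State.view, Action.tag]
  | dbRecv w v o =>
    have hl := h₃ (.operation w)
    simp only [Action.pop, Action.push, Action.single_operation, if_true, List.append_nil,
      ne_eq, reduceCtorEq, not_false_eq_true, Action.single_of_ne] at hl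
    exact ⟨_, .dbRecv s w v o _ hp.1 hl.symm, h₁.symm, h₂.symm, hp.2.symm⟩
  | dbPerform w v o r => exact ⟨_, .dbPerform s w v o r _ hp.1 h₂, h₁.symm, rfl, hp.2.symm⟩
  | dbSend w v r => exact ⟨_, .dbSend s w v r hp.1, h₁.symm, h₂.symm, hp.2.symm⟩

theorem Step.version_of_not_isUpdate {s s' : M.State} {a : M.Action} (h : M.Step s a s')
    (ha : ¬a.IsUpdate) : s'.version = s.version := by
  cases h <;> first | rfl | exact absurd trivial ha

theorem Step.version_eq_updated {s s' : M.State} {a : M.Action} (h : M.Step s a s') {w : M.Worker}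
    (hw : s.version w = .updated) : s'.version w = .updated := by
  cases h with
  | update w' => by_cases e : w = w' <;> simp_all
  | _ => exact hw

/-- The local state of client `c` that an event leads to, together with the action of the event,
if it is an event of client `c`. -/
def Event.entry? (c : M.Client) (e : M.Event) : Option (M.Action × M.ClientState) :=
  if h : e.act.tag = .client c then some (e.act, cast (congrArg Tag.Local h) e.dest) else none

theorem Event.entry?_eq (c : M.Client) {e : M.Event} {s : M.State} (he : e.dest = s.loc e.act.tag) :
    e.entry? c = if e.act.client? = some c then some (e.act, s.client c) else none := by
  unfold entry?
  by_cases h : e.act.tag = .client c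
  · rw [dif_pos h, if_pos (Action.client?_eq_some_iff.2 h), he]
    -- The tag is generalized so that the equation can be substituted and the cast disappears.
    have key : ∀ (t : M.Tag) (h : t = .client c),
        cast (congrArg Tag.Local h) (s.loc t) = s.client c := by
      rintro _ rfl
      rfl
    rw [key _ h]
  · rw [dif_neg h, if_neg (mt Action.client?_eq_some_iff.1 h)]

/-- The steps of the system with events as labels. -/
def EventStep (M : Microservice.{u}) (s : M.State) (e : M.Event) (s' : M.State) : Prop :=
  M.Step s e.act s' ∧ e.dest = s'.loc e.act.tag

theorem EventStep.view {s s' : M.State} {e : M.Event} (h : M.EventStep s e s') :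
    s.view.Step e s'.view := by
  obtain ⟨a, x, l⟩ := e
  obtain ⟨h₁, h₂⟩ := h
  dsimp only at h₂
  subst h₂
  exact h₁.view l

/-- The relaxed system drops two constraints, which return here as `hp` and `hv`. The alternatives
in `hv` fit the blocks of the sort: before the updates all workers are non-updated, and from then on
no non-updated request is sent. -/
theorem Path.exists_eventStep {s : M.State} {l : List M.Event} {S : M.View} {ph : M.DbPhase}
    (h : Path View.Step s.view l S) (hp : Path DbPhase.Step s.phase (l.map Event.act) ph)
    (hv : ((∀ w, s.version w = .nonUpdated) ∧ ∀ e ∈ l, ¬e.act.IsUpdate) ∨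
      ∀ e ∈ l, ∀ c w q, e.act ≠ .clientSend c w .nonUpdated q) :
    ∃ s' : M.State, Path M.EventStep s l s' ∧ s'.view = S ∧ s'.phase = ph := by
  induction l generalizing s with
  | nil => exact ⟨s, rfl, h, hp⟩
  | cons e l ih =>
    obtain ⟨R, h₁, h₂⟩ := h
    obtain ⟨ph', hp₁, hp₂⟩ := hp
    obtain ⟨r, hr, rfl, rfl⟩ := h₁.exists_step hp₁ fun c w q he => by
      rcases hv with hv | hv
      · exact hv.1 w
      · exact absurd he (hv e (by simp) c w q)
    obtain ⟨s', h', hs'⟩ := ih h₂ hp₂ <| by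
      rcases hv with hv | hv
      · rw [hr.version_of_not_isUpdate (hv.2 e (by simp))]
        exact .inl ⟨hv.1, fun e' he' => hv.2 e' (by simp [he'])⟩
      · exact .inr fun e' he' => hv e' (by simp [he'])
    refine ⟨s', ⟨r, ⟨hr, ?_⟩, h'⟩, hs'⟩
    have : r.loc = Function.update s.loc e.act.tag e.dest := h₁.2.1
    rw [this, Function.update_self]

/-! ### Database phases filtered by version -/

/-- The phase `ph`, if it is a transaction of a version that satisfies `q`. -/
def DbPhase.restrict (q : Version → Prop) : M.DbPhase → M.DbPhase
  | .idle => .idle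
  | .received w v o => if q v then .received w v o else .idle
  | .performed w v r => if q v then .performed w v r else .idle

/-- All three actions of a transaction carry the same version, so the filter keeps or drops it as a
whole, and a dropped transaction reads as an idle database. Unlabelled events do not affect the
phase, so `p` is arbitrary on them. -/
theorem DbPhase.path_filter {q : Version → Prop} {p : M.Event → Bool} {ph ph' : M.DbPhase}
    {l : List M.Event} (h : Path DbPhase.Step ph (l.map Event.act) ph')
    (hp : ∀ e ∈ l, ∀ v, e.act.label? = some v → (p e = true ↔ q v)) :
    Path DbPhase.Step (ph.restrict q) ((l.filter p).map Event.act) (ph'.restrict q) := by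
  induction l generalizing ph with
  | nil => exact congrArg _ h
  | cons e l ih =>
    obtain ⟨r, h₁, h₂⟩ := h
    have h₃ := ih h₂ fun e' he' => hp e' (by simp [he'])
    have hq := hp e (by simp)
    cases he : p e with
    | true =>
      simp only [List.filter_cons, he, if_true, List.map_cons]
      refine ⟨_, ?_, h₃⟩
      generalize e.act = a at *
      cases a <;> simp_all [Action.label?, DbPhase.Step, DbPhase.restrict]
    | false =>
      simp only [List.filter_cons, he, Bool.false_eq_true, if_false]
      convert h₃ using 1
      generalize e.act = a at *
      cases a <;> simp_all [Action.label?, DbPhase.Step, DbPhase.restrict]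

/-! ### Invariants of workers and clients -/

/-- The operations and results of a worker that are in transit carry its current
version, and there are as many of them as the worker awaits. -/
structure State.WorkerConsistent (s : M.State) (w : M.Worker) : Prop where
  ops : ∀ m ∈ s.ops w, m.1 = s.version w
  received : ∀ m ∈ s.phase.receivedFrom w, m.1 = s.version w
  performed : ∀ m ∈ s.phase.performedFor w, m.1 = s.version w
  results : ∀ m ∈ s.results w, m.1 = s.version w
  awaiting : s.awaiting w = (s.ops w).length + (s.phase.receivedFrom w).length +
    (s.phase.performedFor w).length + (s.results w).length

theorem State.Initial.workerConsistent {s : M.State} (h : s.Initial) (w : M.Worker) :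
    s.WorkerConsistent w := by
  obtain ⟨-, -, h₁, h₂, -, -, h₃, h₄⟩ := h
  constructor <;> simp [h₁, h₂, h₃, h₄, DbPhase.receivedFrom, DbPhase.performedFor]

/-- The version changes only in an update. A quiescent worker awaits nothing, so by the count
nothing of it is in transit with the old version. -/
theorem Step.workerConsistent {s s' : M.State} {a : M.Action} (h : M.Step s a s') {w : M.Worker}
    (hs : s.WorkerConsistent w) : s'.WorkerConsistent w := by
  obtain ⟨h₁, h₂, h₃, h₄, h₅⟩ := hs
  cases h with
  | dbRecv w' v o l hp hl =>
    have hv : w' = w → v = s.version w := by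
      rintro rfl
      exact h₁ (v, o) (by simp [hl])
    constructor <;>
      simp only [Function.update_apply, DbPhase.receivedFrom, DbPhase.performedFor, hp] at * <;>
      grind
  | dbPerform w' v o r d hp hd =>
    have hv : w' = w → v = s.version w := by
      rintro rfl
      exact h₂ (v, o) (by simp [hp, DbPhase.receivedFrom])
    constructor <;>
      simp only [DbPhase.receivedFrom, DbPhase.performedFor, hp] at * <;>
      grind
  | _ =>
    constructor <;>
      simp only [Function.update_apply, DbPhase.receivedFrom, DbPhase.performedFor,
        State.Quiescent, *] at * <;>
      grind

/-- The number of non-updated relays of client `c` in progress with worker `w`. -/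
def State.relays (s : M.State) (c : M.Client) (w : M.Worker) : ℕ :=
  (s.reqs c w).countP (fun m => decide (m.1 = .nonUpdated)) +
  (if s.version w = .nonUpdated then (s.serving w).count c else 0) +
  (s.resps w c).countP (fun m => decide (m.1 = .nonUpdated))

def Action.startsRelay (c : M.Client) (w : M.Worker) : M.Action → Prop
  | .clientSend c' w' v _ => c = c' ∧ w = w' ∧ v = .nonUpdated
  | _ => False

def Action.endsRelay (c : M.Client) (w : M.Worker) : M.Action → Prop
  | .clientRecv c' w' v _ => c = c' ∧ w = w' ∧ v = .nonUpdated
  | _ => False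

/-- A relay in progress is counted in exactly one place: request channel, worker or response
channel. An update loses none, since a quiescent worker serves no request. -/
theorem Step.relays {s s' : M.State} {a : M.Action} (h : M.Step s a s') (c : M.Client)
    (w : M.Worker) :
    s'.relays c w + (if a.endsRelay c w then 1 else 0) =
      s.relays c w + (if a.startsRelay c w then 1 else 0) := by
  cases h <;>
    simp only [State.relays, Function.update_apply, Action.startsRelay, Action.endsRelay,
      State.Quiescent] at * <;>
    grind [Multiset.count_cons, Multiset.count_zero]

/-- The memory of the algorithm agrees with the relays of client `c` that are in progress. -/
structure State.ClientConsistent [Fintype M.Worker] (s : M.State) (κ : M.Controller)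
    (c : M.Client) : Prop where
  reqs : ∀ w, ∀ m ∈ s.reqs c w, m.1 = .updated → c ∈ κ.moved
  serving : ∀ w, s.version w = .updated → c ∈ s.serving w → c ∈ κ.moved
  resps : ∀ w, ∀ m ∈ s.resps w c, m.1 = .updated → c ∈ κ.moved
  pending : κ.pending c = ∑ w, s.relays c w
  moved : c ∈ κ.moved → κ.pending c = 0

theorem State.Initial.clientConsistent [Fintype M.Worker] {s : M.State} (h : s.Initial)
    (c : M.Client) : s.ClientConsistent (Controller.start M) c := by
  obtain ⟨-, h₁, -, -, h₂, h₃, -, -⟩ := h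
  constructor <;> simp [h₁, h₂, h₃, Controller.start, State.relays]

theorem Controller.moved_subset (κ : M.Controller) (a : M.Action) :
    κ.moved ⊆ (κ.next a).moved := by
  cases a with
  | clientSend c w v q => cases v <;> simp [next]
  | clientRecv c w v p => cases v <;> simp [next]
  | dbPerform w v o r => cases v <;> simp [next]
  | _ => exact subset_rfl

theorem Controller.log_subset (κ : M.Controller) (a : M.Action) :
    κ.log ⊆ (κ.next a).log := by
  cases a with
  | clientSend c w v q => cases v <;> simp [next]
  | clientRecv c w v p => cases v <;> simp [next]
  | dbPerform w v o r => cases v <;> simp [next]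
  | _ => exact subset_rfl

theorem Step.pending [Fintype M.Worker] {s s' : M.State} {a : M.Action} (h : M.Step s a s')
    {κ : M.Controller} {c : M.Client} (hs : κ.pending c = ∑ w, s.relays c w) :
    (κ.next a).pending c = ∑ w, s'.relays c w := by
  have hsum := Finset.sum_congr (rfl : Finset.univ = Finset.univ) fun w _ => h.relays c w
  simp only [Finset.sum_add_distrib, ← hs] at hsum
  cases a with
  | clientSend c' w v q =>
    cases v <;> by_cases e : c = c' <;>
      simp_all [Controller.next, Action.startsRelay, Action.endsRelay]
  | clientRecv c' w v p =>
    cases v <;> by_cases e : c = c' <;>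
      simp_all [Controller.next, Action.startsRelay, Action.endsRelay]
    -- The subtraction in `next` is not truncated: by `hsum` the relay that ends here was counted in
    -- `pending`.
    omega
  | dbPerform w v o r =>
    cases v <;> simpa [Controller.next, Action.startsRelay, Action.endsRelay] using hsum.symm
  | _ => simpa [Controller.next, Action.startsRelay, Action.endsRelay] using hsum.symm

theorem Step.clientConsistent [Fintype M.Worker] {s s' : M.State} {a : M.Action}
    (h : M.Step s a s') {κ : M.Controller} (ha : κ.Allows a) {c : M.Client}
    (hs : s.ClientConsistent κ c) : s'.ClientConsistent (κ.next a) c := by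
  have hp := h.pending hs.pending
  have hm := κ.moved_subset a
  obtain ⟨h₁, h₂, h₃, h₄, h₅⟩ := hs
  refine ⟨?_, ?_, ?_, hp, ?_⟩
  · cases h with
    | clientSend c' w' v q x hx hv =>
      cases v <;> simp only [Function.update_apply, Controller.next] at * <;> grind
    | workerRecvReq w' v c' q y l hy hv hl =>
      simp only [Function.update_apply, Controller.next] at *
      grind
    | _ => exact fun w m hm' hv => hm (h₁ w m hm' hv)
  · cases h with
    | update w' y hy hv hq =>
      simp only [Function.update_apply, Controller.next, State.Quiescent] at *
      grind
    | workerRecvReq w' v c' q y l hy hv hl =>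
      have hq : c' = c → v = .updated → c ∈ κ.moved := by
        rintro rfl
        exact h₁ w' (v, q) (by simp [hl])
      simp only [Function.update_apply, Controller.next] at *
      grind
    | workerSendResp w' v c' p y m hy hv hm =>
      simp only [Function.update_apply, Controller.next] at *
      grind
    | _ => exact fun w hw hc => hm (h₂ w hw hc)
  · cases h with
    | clientRecv c' w' v p x l hx hl =>
      cases v <;> simp only [Function.update_apply, Controller.next] at * <;> grind
    | workerSendResp w' v c' p y m hy hv hm =>
      simp only [Function.update_apply, Controller.next] at *
      grind
    | _ => exact fun w m hm' hv => hm (h₃ w m hm' hv)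
  · cases a with
    | clientSend c' w v q =>
      cases v <;> simp only [Function.update_apply, Controller.next, Controller.Allows] at * <;>
        grind
    | clientRecv c' w v p =>
      cases v <;> simp only [Function.update_apply, Controller.next, Controller.Allows] at * <;>
        grind
    | dbPerform w v o r => cases v <;> exact h₅
    | _ => exact h₅

/-! ### Migration of owners and version labels -/

/-- The owner of an action has been moved to the updated service. -/
def State.Migrated (s : M.State) (κ : M.Controller) : M.Tag → Prop
  | .client c => c ∈ κ.moved
  | .worker w => s.version w = .updated

theorem Step.migrated {s s' : M.State} {a : M.Action} (h : M.Step s a s') {κ : M.Controller}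
    {t : M.Tag} (ht : s.Migrated κ t) : s'.Migrated (κ.next a) t := by
  cases t with
  | client c => exact κ.moved_subset a ht
  | worker w => exact h.version_eq_updated ht

theorem Step.migrated_iff [Fintype M.Worker] {s s' : M.State} {a : M.Action} (h : M.Step s a s')
    {κ : M.Controller} (ha : κ.Allows a) (hw : ∀ w, s.WorkerConsistent w)
    (hc : ∀ c, s.ClientConsistent κ c) {v : Version} (hv : a.label? = some v) :
    s'.Migrated (κ.next a) a.tag ↔ v = .updated := by
  cases h with
  | clientSend c w v' q x hx hv' =>
    cases hv
    cases v with
    | updated => simp [State.Migrated, Action.tag, Controller.next]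
    | nonUpdated =>
      have hm : c ∉ κ.moved := ha
      simpa [State.Migrated, Action.tag, Controller.next] using hm
  | clientRecv c w v' p x l hx hl =>
    cases hv
    cases v with
    | updated => simpa [State.Migrated, Action.tag, Controller.next] using
        (hc c).resps w (.updated, p) (by simp [hl]) rfl
    | nonUpdated =>
      suffices c ∉ κ.moved by simpa [State.Migrated, Action.tag, Controller.next] using this
      intro hm
      have h₁ := (hc c).moved hm
      rw [(hc c).pending, Finset.sum_eq_zero_iff] at h₁
      simpa [State.relays, hl] using h₁ w (Finset.mem_univ w)
  | clientInternal c x hx => cases hv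
  | update w y hy hv' hq => cases hv
  | dbRecv w v' o l hp hl =>
    cases hv
    change s.version w = .updated ↔ v = .updated
    rw [← show v = s.version w from (hw w).ops (v, o) (by simp [hl])]
  | dbPerform w v' o r d hp hd =>
    cases hv
    change s.version w = .updated ↔ v = .updated
    rw [← show v = s.version w from (hw w).received (v, o) (by simp [hp, DbPhase.receivedFrom])]
  | dbSend w v' r hp =>
    cases hv
    change s.version w = .updated ↔ v = .updated
    rw [← show v = s.version w from (hw w).performed (v, r) (by simp [hp, DbPhase.performedFor])]
  | _ =>
    cases hv
    simp_all [State.Migrated, Action.tag]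

theorem Step.update_migrated {s s' : M.State} {a : M.Action} (h : M.Step s a s')
    {κ : M.Controller} (ha : a.IsUpdate) :
    ¬s.Migrated κ a.tag ∧ s'.Migrated (κ.next a) a.tag := by
  cases h with
  | update w y hy hv hq => simp [State.Migrated, Action.tag, hv]
  | _ => exact ha.elim

theorem Step.finite_updated {s s' : M.State} {a : M.Action} (h : M.Step s a s')
    (hs : {w | s.version w = .updated}.Finite) : {w | s'.version w = .updated}.Finite := by
  cases h with
  | update w y hy hv hq =>
    refine (hs.insert w).subset fun w' hw' => ?_
    by_cases e : w' = w <;> simp_all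
  | _ => exact hs

theorem Step.not_isUpdate {s s' : M.State} {a : M.Action} (h : M.Step s a s')
    (hs : ∀ w, s.version w = .updated) : ¬a.IsUpdate := by
  cases h with
  | update w y hy hv hq => simp [hs w] at hv
  | _ => exact id

theorem Action.IsUpdate.label?_eq_none {a : M.Action} (ha : a.IsUpdate) : a.label? = none := by
  cases a <;> first | rfl | exact ha.elim

theorem Action.IsUpdate.client?_eq_none {a : M.Action} (ha : a.IsUpdate) : a.client? = none := by
  cases a <;> first | rfl | exact ha.elim

theorem Action.eq_dbPerform_of_transaction? {a : M.Action} {t : M.Op × M.Result}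
    (h : a.transaction? = some t) : ∃ w v, a = .dbPerform w v t.1 t.2 := by
  cases a <;> simp [transaction?] at h
  subst h
  exact ⟨_, _, rfl⟩

theorem DbPhase.restrict_of_forall {q : Version → Prop} {ph : M.DbPhase}
    (h₁ : ∀ w, ∀ m ∈ ph.receivedFrom w, q m.1) (h₂ : ∀ w, ∀ m ∈ ph.performedFor w, q m.1) :
    ph.restrict q = ph := by
  cases ph with
  | idle => rfl
  | received w v o => exact if_pos (h₁ w (v, o) (by simp [receivedFrom]))
  | performed w v r => exact if_pos (h₂ w (v, r) (by simp [performedFor]))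

theorem DbPhase.restrict_of_forall_not {q : Version → Prop} {ph : M.DbPhase}
    (h₁ : ∀ w, ∀ m ∈ ph.receivedFrom w, ¬q m.1) (h₂ : ∀ w, ∀ m ∈ ph.performedFor w, ¬q m.1) :
    ph.restrict q = .idle := by
  cases ph with
  | idle => rfl
  | received w v o => exact if_neg (h₁ w (v, o) (by simp [receivedFrom]))
  | performed w v r => exact if_neg (h₂ w (v, r) (by simp [performedFor]))

namespace Computation

variable {ρ : M.Computation}

theorem invariant {P : ℕ → Prop} (h0 : P 0)
    (h : ∀ n : ℕ, (n : ℕ∞) < ρ.len → P n → P (n + 1)) : ∀ n : ℕ, (n : ℕ∞) ≤ ρ.len → P n := by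
  intro n
  induction n with
  | zero => exact fun _ => h0
  | succ n ih =>
    intro hn
    have hlt : (n : ℕ∞) < ρ.len := lt_of_lt_of_le (by exact_mod_cast n.lt_succ_self) hn
    exact h n hlt (ih hlt.le)

theorem lt_len {i n : ℕ} (hi : i < n) (hn : (n : ℕ∞) ≤ ρ.len) : (i : ℕ∞) < ρ.len :=
  lt_of_lt_of_le (by exact_mod_cast hi) hn

theorem le_len {i n : ℕ} (hi : i ≤ n) (hn : (n : ℕ∞) ≤ ρ.len) : (i : ℕ∞) ≤ ρ.len :=
  le_trans (by exact_mod_cast hi) hn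

theorem monotone {P : ℕ → Prop} (h : ∀ n : ℕ, (n : ℕ∞) < ρ.len → P n → P (n + 1)) {i j : ℕ}
    (hij : i ≤ j) (hj : (j : ℕ∞) ≤ ρ.len) (hi : P i) : P j := by
  induction j, hij using Nat.le_induction with
  | base => exact hi
  | succ j _ ih =>
    have hlt := lt_len j.lt_succ_self hj
    exact h j hlt (ih hlt.le)

theorem workerConsistent (ρ : M.Computation) {n : ℕ} (hn : (n : ℕ∞) ≤ ρ.len) (w : M.Worker) :
    (ρ.st n).WorkerConsistent w :=
  invariant (P := fun n => (ρ.st n).WorkerConsistent w) (ρ.initial.workerConsistent w)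
    (fun n hn => (ρ.step n hn).workerConsistent) n hn

theorem Controlled.clientConsistent [Fintype M.Worker] (hρ : ρ.Controlled) {n : ℕ}
    (hn : (n : ℕ∞) ≤ ρ.len) (c : M.Client) :
    (ρ.st n).ClientConsistent (ρ.controller n) c :=
  invariant (P := fun n => (ρ.st n).ClientConsistent (ρ.controller n) c)
    (ρ.initial.clientConsistent c) (fun n hn => (ρ.step n hn).clientConsistent (hρ n hn)) n hn

theorem Updates.finite_worker (hu : ρ.Updates) : Finite M.Worker := by
  obtain ⟨n, hn, h⟩ := hu
  have := invariant (ρ := ρ) (P := fun n => {w | (ρ.st n).version w = .updated}.Finite)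
    (by simp [ρ.initial.1]) (fun n hn => (ρ.step n hn).finite_updated) n hn
  simp only [h, Set.ofPred_true] at this
  exact Set.finite_univ_iff.1 this

/-- The tag `t` has been moved to the updated service after `n` steps. -/
def Migrated (ρ : M.Computation) (n : ℕ) (t : M.Tag) : Prop :=
  (ρ.st n).Migrated (ρ.controller n) t

theorem Migrated.mono {i j : ℕ} {t : M.Tag} (h : ρ.Migrated i t) (hij : i ≤ j)
    (hj : (j : ℕ∞) ≤ ρ.len) : ρ.Migrated j t :=
  monotone (P := fun n => ρ.Migrated n t) (fun n hn => (ρ.step n hn).migrated) hij hj h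

/-- The event of step `i` of a computation. -/
def event (ρ : M.Computation) (i : ℕ) : M.Event :=
  ⟨ρ.act i, (ρ.st (i + 1)).loc (ρ.act i).tag, decide (ρ.Migrated (i + 1) (ρ.act i).tag)⟩

theorem event_late {i : ℕ} : (ρ.event i).late = true ↔ ρ.Migrated (i + 1) (ρ.act i).tag := by
  simp [event]

theorem event_late_eq_false {i : ℕ} :
    (ρ.event i).late = false ↔ ¬ρ.Migrated (i + 1) (ρ.act i).tag := by
  simp [event]

theorem eventStep {i : ℕ} (hi : (i : ℕ∞) < ρ.len) :
    M.EventStep (ρ.st i) (ρ.event i) (ρ.st (i + 1)) :=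
  ⟨ρ.step i hi, rfl⟩

theorem Controlled.migrated_iff [Fintype M.Worker] (hρ : ρ.Controlled) {i : ℕ}
    (hi : (i : ℕ∞) < ρ.len) {v : Version} (hv : (ρ.act i).label? = some v) :
    ρ.Migrated (i + 1) (ρ.act i).tag ↔ v = .updated :=
  (ρ.step i hi).migrated_iff (hρ i hi) (ρ.workerConsistent hi.le) (hρ.clientConsistent hi.le) hv

theorem update_migrated {i : ℕ} (hi : (i : ℕ∞) < ρ.len) (h : (ρ.act i).IsUpdate) :
    ¬ρ.Migrated i (ρ.act i).tag ∧ ρ.Migrated (i + 1) (ρ.act i).tag :=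
  (ρ.step i hi).update_migrated h

theorem mem_log {i j : ℕ} {w : M.Worker} {t : M.Op × M.Result}
    (ha : ρ.act i = .dbPerform w .updated t.1 t.2) (hij : i < j) (hj : (j : ℕ∞) ≤ ρ.len) :
    t ∈ (ρ.controller j).log := by
  refine monotone (ρ := ρ) (P := fun n => t ∈ (ρ.controller n).log)
    (fun n _ h => Controller.log_subset _ _ h) hij hj ?_
  simp [controller, ha, Controller.next]

/-- A late event can be postponed behind a subsequent early one. -/
theorem Controlled.swaps_early [Fintype M.Worker] (hρ : ρ.Controlled) {i j : ℕ} (hij : i < j)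
    (hj : (j : ℕ∞) < ρ.len) (hi' : (ρ.event i).late = true) (hj' : (ρ.event j).late = false) :
    Swaps View.Step (ρ.event i) (ρ.event j) := by
  have hi : (i : ℕ∞) < ρ.len := lt_len hij hj.le
  have hj₁ : ((j + 1 : ℕ) : ℕ∞) ≤ ρ.len := by exact_mod_cast Order.add_one_le_of_lt hj
  rw [event_late] at hi'
  rw [event_late_eq_false] at hj'
  refine View.swaps (fun ht => ?_) (fun v hv hv' => ?_) fun t t' ht ht' => ?_
  · exact hj' (ht ▸ hi'.mono (by omega) hj₁)
  · exact hj' ((hρ.migrated_iff hj hv').2 ((hρ.migrated_iff hi hv).1 hi'))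
  · obtain ⟨w, v, hw⟩ := Action.eq_dbPerform_of_transaction? ht
    obtain ⟨w', v', hw'⟩ := Action.eq_dbPerform_of_transaction? ht'
    have hw₁ : ρ.act i = .dbPerform w v t.1 t.2 := hw
    have hw₁' : ρ.act j = .dbPerform w' v' t'.1 t'.2 := hw'
    have hv := (hρ.migrated_iff hi (v := v) (by rw [hw₁]; rfl)).1 hi'
    have hv' := mt (hρ.migrated_iff hj (v := v') (by rw [hw₁']; rfl)).2 hj'
    subst hv
    cases v' with
    | updated => exact absurd rfl hv'
    | nonUpdated =>
      have := hρ j hj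
      rw [hw₁'] at this
      exact this t (mem_log hw₁ hij hj.le)

/-- A late event that is not an update can be postponed behind a subsequent update. -/
theorem swaps_update {i j : ℕ} (hij : i < j) (hj : (j : ℕ∞) < ρ.len)
    (hi' : (ρ.event i).late = true) (hj' : (ρ.act j).IsUpdate) :
    Swaps View.Step (ρ.event i) (ρ.event j) := by
  rw [event_late] at hi'
  refine View.swaps (fun ht => ?_) (fun v _ hv' => ?_) fun t t' _ ht' => ?_
  · exact (update_migrated hj hj').1 (ht ▸ hi'.mono hij hj.le)
  · exact absurd (hj'.label?_eq_none.symm.trans hv') (by simp)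
  · obtain ⟨w', v', hw'⟩ := Action.eq_dbPerform_of_transaction? ht'
    have hw₁' : ρ.act j = .dbPerform w' v' t'.1 t'.2 := hw'
    rw [hw₁'] at hj'
    exact hj'.elim

/-- The events of the first `n` steps. -/
def events (ρ : M.Computation) (n : ℕ) : List M.Event := (List.range n).map ρ.event

theorem pairwise_events {n : ℕ} {r : M.Event → M.Event → Prop}
    (h : ∀ i j, i < j → j < n → r (ρ.event i) (ρ.event j)) : (ρ.events n).Pairwise r := by
  rw [events, List.pairwise_map]
  exact List.pairwise_lt_range.imp_of_mem fun _ hj hij => h _ _ hij (List.mem_range.1 hj)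

theorem mem_events {n : ℕ} {e : M.Event} (he : e ∈ ρ.events n) : ∃ i < n, ρ.event i = e := by
  simpa [events] using he

def early (ρ : M.Computation) (n : ℕ) : List M.Event :=
  (ρ.events n).filter fun e => !e.late

def updates (ρ : M.Computation) (n : ℕ) : List M.Event :=
  ((ρ.events n).filter fun e => !!e.late).filter fun e => decide e.act.IsUpdate

def late (ρ : M.Computation) (n : ℕ) : List M.Event :=
  ((ρ.events n).filter fun e => !!e.late).filter fun e => !decide e.act.IsUpdate

theorem not_isUpdate_of_mem_early {n : ℕ} (hn : (n : ℕ∞) ≤ ρ.len) {e : M.Event}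
    (he : e ∈ ρ.early n) : ¬e.act.IsUpdate := by
  obtain ⟨he, hl⟩ := List.mem_filter.1 he
  obtain ⟨i, hi, rfl⟩ := mem_events he
  intro hu
  exact event_late_eq_false.1 (by simpa using hl) (update_migrated (lt_len hi hn) hu).2

theorem Controlled.path_sorted [Fintype M.Worker] (hρ : ρ.Controlled) {n : ℕ}
    (hn : (n : ℕ∞) ≤ ρ.len) (hu : ∀ w, (ρ.st n).version w = .updated) :
    Path M.EventStep (ρ.st 0) (ρ.early n ++ (ρ.updates n ++ ρ.late n)) (ρ.st n) := by
  have hp : Path View.Step (ρ.st 0).view (ρ.events n) (ρ.st n).view :=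
    Path.of_states (f := fun i => (ρ.st i).view) fun i hi => (eventStep (lt_len hi hn)).view
  obtain ⟨S, h₁, h₂⟩ := Path.append_iff.1 <| hp.filter_append_filter_not (fun e => !e.late) <|
    pairwise_events fun i j hij hj hi' hj' =>
      hρ.swaps_early hij (lt_len hj hn) (by simpa using hi') (by simpa using hj')
  have h₃ := h₂.filter_append_filter_not (fun e => decide e.act.IsUpdate) <| by
    rw [List.pairwise_filter]
    exact pairwise_events fun i j hij hj hi' _ _ hj' =>
      swaps_update hij (lt_len hj hn) (by simpa using hi') (of_decide_eq_true hj')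
  have hlabel : ∀ e ∈ ρ.events n, ∀ v, e.act.label? = some v → (e.late = true ↔ v = .updated) := by
    intro e he v hv
    obtain ⟨i, hi, rfl⟩ := mem_events he
    rw [event_late]
    exact hρ.migrated_iff (lt_len hi hn) hv
  have hph : Path DbPhase.Step (.idle : M.DbPhase) ((ρ.events n).map Event.act) (ρ.st n).phase := by
    rw [events, List.map_map, ← ρ.initial.2.2.2.1]
    exact Path.of_states (f := fun i => (ρ.st i).phase) fun i hi => (ρ.step i (lt_len hi hn)).phase
  have hrec : ∀ w, ∀ m ∈ (ρ.st n).phase.receivedFrom w, m.1 = .updated := fun w m hm =>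
    ((ρ.workerConsistent hn w).received m hm).trans (hu w)
  have hper : ∀ w, ∀ m ∈ (ρ.st n).phase.performedFor w, m.1 = .updated := fun w m hm =>
    ((ρ.workerConsistent hn w).performed m hm).trans (hu w)
  have hph₁ : Path DbPhase.Step (.idle : M.DbPhase) ((ρ.early n).map Event.act) .idle := by
    have := DbPhase.path_filter (q := (· = .nonUpdated)) (p := fun e => !e.late) hph
      fun e he v hv => by
        rw [Bool.not_eq_true', ← Bool.not_eq_true, hlabel e he v hv]
        cases v <;> simp
    rwa [DbPhase.restrict_of_forall_not (ph := (ρ.st n).phase)] at this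
    · exact fun w m hm => by simp [hrec w m hm]
    · exact fun w m hm => by simp [hper w m hm]
  have hph₂ : Path DbPhase.Step (.idle : M.DbPhase) ((ρ.updates n).map Event.act) .idle := by
    have := DbPhase.path_filter (q := fun _ => False)
      (p := fun e => decide e.act.IsUpdate && !!e.late) hph fun e he v hv => by
        have : ¬e.act.IsUpdate := fun h => by simp [h.label?_eq_none] at hv
        simp [this]
    rw [updates, List.filter_filter]
    rwa [DbPhase.restrict_of_forall_not (ph := (ρ.st n).phase)] at this <;> simp
  have hph₃ : Path DbPhase.Step (.idle : M.DbPhase) ((ρ.late n).map Event.act)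
      (ρ.st n).phase := by
    have := DbPhase.path_filter (q := (· = .updated))
      (p := fun e => !decide e.act.IsUpdate && !!e.late) hph fun e he v hv => by
        have h : ¬e.act.IsUpdate := fun h => by simp [h.label?_eq_none] at hv
        simpa [h] using hlabel e he v hv
    rw [late, List.filter_filter]
    rwa [DbPhase.restrict_of_forall (ph := (ρ.st n).phase) hrec hper] at this
  obtain ⟨s, hs, rfl, hs'⟩ := h₁.exists_eventStep (ph := .idle)
    (by rw [ρ.initial.2.2.2.1]; exact hph₁)
    (.inl ⟨ρ.initial.1, fun e he => not_isUpdate_of_mem_early hn he⟩)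
  obtain ⟨s', ht, ht₁, ht₂⟩ := h₃.exists_eventStep (ph := (ρ.st n).phase)
    (by rw [hs', List.map_append]; exact Path.append_iff.2 ⟨_, hph₂, hph₃⟩)
    (.inr fun e he c w q ha => by
      have he' : e ∈ ρ.events n ∧ e.late = true := by
        rcases List.mem_append.1 he with he | he <;>
          simpa using List.mem_filter.1 (List.mem_filter.1 he).1
      have := (hlabel e he'.1 .nonUpdated (by rw [ha]; rfl)).1 he'.2
      cases this)
  rw [← State.eq_of_view_eq ht₁ ht₂]
  exact Path.append_iff.2 ⟨s, hs, ht⟩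

theorem length_sorted (ρ : M.Computation) (n : ℕ) :
    (ρ.early n ++ (ρ.updates n ++ ρ.late n)).length = n := by
  have h (l : List M.Event) (p : M.Event → Bool) :
      (l.filter p).length + (l.filter fun e => !p e).length = l.length := by
    induction l with
    | nil => rfl
    | cons e l ih => cases he : p e <;> simp [he] <;> omega
  rw [List.length_append, List.length_append, updates, late,
    h _ fun e => decide e.act.IsUpdate, early, h _ fun e => !e.late]
  simp [events]

/-- Sorting does not affect the order of the events of a client. -/
theorem filterMap_sorted {n : ℕ} (hn : (n : ℕ∞) ≤ ρ.len) (c : M.Client) :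
    (ρ.early n ++ (ρ.updates n ++ ρ.late n)).filterMap (Event.entry? c) =
      (ρ.events n).filterMap (Event.entry? c) := by
  have h (l : List M.Event) : l.filterMap (Event.entry? c) =
      (l.filter fun e => decide (e.act.tag = .client c)).filterMap (Event.entry? c) := by
    rw [List.filterMap_filter]
    congr 1
    funext e
    by_cases he : e.act.tag = .client c <;> simp [Event.entry?, he]
  rw [h, h (ρ.events n), List.filter_append, List.filter_append, early, updates, late]
  simp only [List.filter_comm fun e : M.Event => decide (e.act.tag = .client c)]
  rw [List.filter_append_filter_not_of_pairwise, List.filter_append_filter_not_of_pairwise]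
  · rw [List.pairwise_filter]
    refine pairwise_events fun i j hij hj hi' hj' => ?_
    simp only [Bool.not_eq_false', event_late, decide_eq_true_eq] at *
    rw [show (ρ.act j).tag = (ρ.act i).tag from hj'.trans hi'.symm]
    exact fun h => h.mono (by omega) (le_len (Nat.succ_le_of_lt hj) hn)
  · refine List.pairwise_of_forall_mem_list fun e _ e' he' _ => ?_
    have he' := (List.mem_filter.1 (List.mem_filter.1 he').1).2
    simp only [decide_eq_true_eq, decide_eq_false_iff_not] at *
    intro hu
    have := Action.client?_eq_some_iff.2 he'
    simp [hu.client?_eq_none] at this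

theorem timeline_succ (ρ : M.Computation) (c : M.Client) (n : ℕ) :
    ρ.timeline c (n + 1) = ρ.timeline c n ++
      (if (ρ.act n).client? = some c then some (ρ.act n, (ρ.st (n + 1)).client c)
        else none).toList := by
  by_cases h : (ρ.act n).client? = some c <;> simp [timeline, List.range_succ, h]

theorem timeline_prefix (ρ : M.Computation) (c : M.Client) {m n : ℕ} (h : m ≤ n) :
    ρ.timeline c m <+: ρ.timeline c n := by
  induction n, h using Nat.le_induction with
  | base => exact List.prefix_rfl
  | succ n _ ih => exact ih.trans (by rw [timeline_succ]; exact List.prefix_append _ _)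

theorem timeline_eq_of_eventStep {c : M.Client} {l : List M.Event}
    (h : ∀ i (hi : i < l.length), ρ.act i = l[i].act ∧ M.EventStep (ρ.st i) l[i] (ρ.st (i + 1))) :
    ρ.timeline c l.length = l.filterMap (Event.entry? c) := by
  suffices H : ∀ n ≤ l.length, ρ.timeline c n = (l.take n).filterMap (Event.entry? c) by
    rw [H _ le_rfl, List.take_length]
  intro n
  induction n with
  | zero => exact fun _ => rfl
  | succ n ih =>
    intro hn
    have h' := h n hn
    rw [timeline_succ, ih (by omega), List.take_succ_eq_append_getElem hn, List.filterMap_append,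
      h'.1, ← Event.entry?_eq c h'.2.2]
    cases he : l[n].entry? c <;> simp [he]

theorem clientEquiv_of_timeline_eq {ρ ρ' : M.Computation} {c : M.Client} {k : ℕ}
    (hk : (k : ℕ∞) ≤ ρ.len) (hlen : ρ.len = ρ'.len) (h0 : ρ.st 0 = ρ'.st 0)
    (h : ∀ n : ℕ, k ≤ n → (n : ℕ∞) ≤ ρ.len → ρ.timeline c n = ρ'.timeline c n) :
    ClientEquiv c ρ ρ' := by
  have hmax {n : ℕ} (hn : (n : ℕ∞) ≤ ρ.len) : ((max n k : ℕ) : ℕ∞) ≤ ρ.len := by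
    rcases max_choice n k with e | e <;> rwa [e]
  refine ⟨by rw [h0], fun n hn => ⟨max n k, hlen ▸ hmax hn, ?_⟩, fun n hn => ⟨max n k, ?_, ?_⟩⟩
  · rw [← h _ (le_max_right _ _) (hmax hn)]
    exact ρ.timeline_prefix c (le_max_left _ _)
  · exact hmax (hlen ▸ hn)
  · rw [h _ (le_max_right _ _) (hmax (hlen ▸ hn))]
    exact ρ'.timeline_prefix c (le_max_left _ _)

end Computation

theorem Computation.Controlled.updateConsistent {ρ : M.Computation} (hρ : ρ.Controlled)
    (hu : ρ.Updates) : ρ.UpdateConsistent := by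
  have := hu.finite_worker
  have := Fintype.ofFinite M.Worker
  obtain ⟨N, hN, hup⟩ := hu
  intro c
  obtain ⟨f, hf0, hfN, hf⟩ := (hρ.path_sorted hN hup).exists_states
  have hlen := ρ.length_sorted N
  have hupd : ∀ n, N ≤ n → (n : ℕ∞) ≤ ρ.len → ∀ w, (ρ.st n).version w = .updated :=
    fun n hNn hn => Computation.monotone (ρ := ρ)
      (P := fun n => ∀ w, (ρ.st n).version w = .updated)
      (fun n hn h w => (ρ.step n hn).version_eq_updated (h w)) hNn hn hup
  have htl := Computation.filterMap_sorted hN c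
  have hearly := fun e he => Computation.not_isUpdate_of_mem_early (e := e) hN he
  have hmid : ∀ e ∈ ρ.updates N, e.act.IsUpdate := fun e he => by
    simpa using (List.mem_filter.1 he).2
  have hlate : ∀ e ∈ ρ.late N, ¬e.act.IsUpdate := fun e he => by
    simpa using (List.mem_filter.1 he).2
  generalize hL : ρ.early N ++ (ρ.updates N ++ ρ.late N) = L at *
  let ρ' : M.Computation :=
    { len := ρ.len
      st := fun n => if n ≤ N then f n else ρ.st n
      act := fun n => if h : n < L.length then L[n].act else ρ.act n
      initial := by simpa [hf0] using ρ.initial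
      step := fun i hi => by
        rcases lt_trichotomy i N with h | rfl | h
        · simpa [h, h.le, hlen, Nat.succ_le_of_lt h] using (hf i (hlen ▸ h)).1
        · rw [hlen] at hfN
          simpa [hlen, hfN] using ρ.step i hi
        · simpa [hlen, h.not_gt, h.not_ge, show ¬i + 1 ≤ N by omega] using ρ.step i hi }
  have hst : ∀ n, N ≤ n → ρ.st n = ρ'.st n := by
    intro n hn
    rcases hn.eq_or_lt with rfl | hn
    · simp [ρ', ← hfN, hlen]
    · simp [ρ', hn.not_ge]
  have hact : ∀ n, N ≤ n → ρ.act n = ρ'.act n := fun n hn => by simp [ρ', hlen, hn.not_gt]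
  have hst0 : ρ.st 0 = ρ'.st 0 := by simp [ρ', hf0]
  refine ⟨ρ', Computation.clientEquiv_of_timeline_eq hN rfl hst0 fun n hn _ => ?_,
    ⟨hst0, rfl, N, hN, fun n hn _ => hst n hn, fun n hn _ => hact n hn⟩,
    ⟨N, hN, by rwa [← hst N le_rfl]⟩, (ρ.early N).length,
    (ρ.early N).length + (ρ.updates N).length, fun n hn => ?_⟩
  · induction n, hn using Nat.le_induction with
    | base =>
      have h₁ := Computation.timeline_eq_of_eventStep (ρ := ρ) (c := c) (l := ρ.events N)
        fun i hi => by
          simp only [Computation.events, List.length_map, List.length_range] at hi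
          simpa [Computation.events] using
            ⟨rfl, Computation.eventStep (Computation.lt_len hi hN)⟩
      have h₂ := Computation.timeline_eq_of_eventStep (ρ := ρ') (c := c) (l := L) fun i hi => by
        have hi' : i < N := hlen ▸ hi
        simpa [ρ', hi, hi'.le, Nat.succ_le_of_lt hi'] using hf i hi
      simp only [Computation.events, List.length_map, List.length_range] at h₁
      rw [hlen] at h₂
      rw [h₁, h₂, htl, Computation.events]
    | succ n hn ih =>
      rename_i hn'
      rw [Computation.timeline_succ, Computation.timeline_succ,
        ih (Computation.le_len n.le_succ hn'), hact n hn, hst (n + 1) (by omega)]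
  · rcases lt_or_ge n N with h | h
    · have hnL : n < L.length := hlen ▸ h
      have ha : ρ'.act n = L[n].act := by simp [ρ', hnL]
      rw [ha]
      subst hL
      rcases lt_or_ge n (ρ.early N).length with h₁ | h₁
      · rw [List.getElem_append_left h₁]
        exact iff_of_false (hearly _ (List.getElem_mem _)) (by omega)
      · rw [List.getElem_append_right h₁]
        rcases lt_or_ge (n - (ρ.early N).length) (ρ.updates N).length with h₂ | h₂
        · rw [List.getElem_append_left h₂]
          exact iff_of_true (hmid _ (List.getElem_mem _)) (by omega)
        · rw [List.getElem_append_right h₂]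
          exact iff_of_false (hlate _ (List.getElem_mem _)) (by omega)
    · have hle : (ρ.early N).length + (ρ.updates N).length ≤ N := by
        have := ρ.length_sorted N
        simp only [List.length_append] at this
        omega
      rw [← hact n h]
      exact iff_of_false ((ρ.step n hn).not_isUpdate (hupd n h hn.le)) (by omega)

end

end Microservice

theorem mainTheorem1 (M : Microservice.{u}) (ρ : M.Computation)
    (hρ : ρ.Controlled) (hu : ρ.Updates) : ρ.UpdateConsistent :=
  hρ.updateConsistent hu
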